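/- Let $\&$ be a continuous t-norm on $[0,1]$, i.e. a continuous, commutative, associative, monotone binary operation on $[0,1]$ with unit $1$, and let $p\to r=\sup\{q\in[0,1] : p\,\&\,q\le r\}$ be its implication. Assume that $\&$ satisfies condition (S): the map $(p,r)\mapsto (p\to r)$ is continuous at every point of $[0,1]^2$ off the diagonal. A $[0,1]$-ordered set is a set $X$ with a map $X(-,-)\colon X\times X\to[0,1]$ such that $X(x,x)=1$ and $X(y,z)\,\&\,X(x,y)\le X(x,z)$. It is separated if $X(x,y)=X(y,x)=1$ implies $x=y$. A map $f\colon X\to Y$ preserves $[0,1]$-order if $X(x,y)\le Y(f(x),f(y))$ for all $x,y\in X$. A map $f\colon X\to Y$ is left adjoint to $g\colon Y\to X$ (and $g$ is right adjoint to $f$), written $f\dashv g$, if $Y(f(x),y)=X(x,g(y))$ for all $x\in X$, $y\in Y$. A weight of $X$ is a map $\phi\colon X\to[0,1]$ with $\phi(y)\,\&\,X(x,y)\le\phi(x)$; weights are $[0,1]$-ordered by $\mathcal PX(\phi,\psi)=\bigwedge_{x}(\phi(x)\to\psi(x))$. An element $a$ is a supremum of $\phi$ if $X(a,y)=\mathcal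 PX(\phi,X(-,y))$ for all $y\in X$. $X$ is complete if every weight of $X^{\mathrm{op}}$ has a supremum in $X^{\mathrm{op}}$, where $X^{\mathrm{op}}(x,y)=X(y,x)$. For a $[0,1]$-order-preserving $f\colon X\to Y$ put $f^{\to}(\phi)(y)=\bigvee_{x}\phi(x)\,\&\,Y(y,f(x))$. A weight is forward Cauchy if it has the form $\bigvee_i\bigwedge_{j\ge i}X(-,x_j)$ for some net $\{x_i\}$ in $X$ (indexed by a nonempty directed set) with $\bigvee_i\bigwedge_{i\le j\le l}X(x_j,x_l)=1$; the forward Cauchy weights, with the $[0,1]$-order of $\mathcal PX$, form $\mathcal DX$. Let $\mathsf y\colon X\to\mathcal DX$, $\mathsf y(x)=X(-,x)$. A continuous $[0,1]$-lattice is a separated complete $[0,1]$-ordered set $X$ for which there are maps $\mathsf d\colon X\to\mathcal DX$ and $\sup\colon\mathcal DX\to X$ with $\mathsf d\dashv\sup\dashv\mathsf y$. A $[0,1]$-order-preserving map $f\colon X\to Y$ is $[0,1]$-Scott continuous if, for every forward Cauchy weight $\phi$ of $X$ and every supremum $a$ of $\phi$, $f(a)$ is a supremum of $f^{\to}(\phi)$.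 Let $[0,1]\text{-}\mathsf{ConLat}$ be the category whose objects are the continuous $[0,1]$-lattices and whose morphisms are the $[0,1]$-Scott continuous maps that are right adjoints (i.e. have a left adjoint). Theorem. The category $[0,1]\text{-}\mathsf{ConLat}$ is monadic over $\mathsf{Set}$: the forgetful functor $U\colon[0,1]\text{-}\mathsf{ConLat}\to\mathsf{Set}$ has a left adjoint, and the comparison functor from $[0,1]\text{-}\mathsf{ConLat}$ to the category of Eilenberg–Moore algebras of the induced monad on $\mathsf{Set}$ is an isomorphism of categories (an equivalence that is bijective on objects). -/

import Mathlib

open scoped unitInterval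
open CategoryTheory

universe u

/-- A continuous t-norm: a continuous commutative, associative, monotone operation on the unit
interval with unit `1`. -/
structure ContTNorm where
  mul : I → I → I
  mul_comm : ∀ p q, mul p q = mul q p
  mul_assoc : ∀ p q r, mul (mul p q) r = mul p (mul q r)
  one_mul : ∀ p, mul 1 p = p
  mul_mono : ∀ p q r, q ≤ r → mul p q ≤ mul p r
  continuous_mul : Continuous fun x : I × I => mul x.1 x.2

namespace ContTNorm

variable (T : ContTNorm)

/-- The implication operator `p → r` of a continuous t-norm. -/
noncomputable def imp (p r : I) : I := sSup {q | T.mul p q ≤ r}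

/-- Condition (S): the implication is continuous at each point off the diagonal. -/
def CondS : Prop :=
  ∀ x : I × I, x.1 ≠ x.2 → ContinuousAt (fun z : I × I => T.imp z.1 z.2) x

theorem mul_one (p : I) : T.mul p 1 = p := by rw [T.mul_comm, T.one_mul]

theorem mul_le_mul {p p' q q' : I} (hp : p ≤ p') (hq : q ≤ q') : T.mul p q ≤ T.mul p' q' :=
  (T.mul_mono p q q' hq).trans (by
    rw [T.mul_comm p, T.mul_comm p']; exact T.mul_mono q' p p' hp)

theorem mul_le_right (p q : I) : T.mul p q ≤ q :=
  (T.mul_le_mul (le_top : p ≤ 1) le_rfl).trans (T.one_mul q).le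

theorem mul_le_left (p q : I) : T.mul p q ≤ p := by
  rw [T.mul_comm]; exact T.mul_le_right q p

theorem mul_sSup (p : I) (s : Set I) : T.mul p (sSup s) = sSup (T.mul p '' s) := by
  have hm : Monotone (T.mul p) := fun q r h => T.mul_mono p q r h
  have hc : Continuous (T.mul p) := T.continuous_mul.comp (Continuous.prodMk_right p)
  exact hm.map_sSup_of_continuousAt hc.continuousAt (le_antisymm (T.mul_le_right p ⊥) bot_le)

theorem mul_iSup {ι : Sort*} (p : I) (f : ι → I) : T.mul p (⨆ i, f i) = ⨆ i, T.mul p (f i) := by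
  rw [iSup, T.mul_sSup, ← Set.range_comp, iSup]; rfl

theorem iSup_mul {ι : Sort*} (p : I) (f : ι → I) : T.mul (⨆ i, f i) p = ⨆ i, T.mul (f i) p := by
  rw [T.mul_comm, T.mul_iSup]; simp only [T.mul_comm]

/-- The adjoint property of the implication. -/
theorem mul_le_iff (p q r : I) : T.mul p q ≤ r ↔ q ≤ T.imp p r := by
  refine ⟨fun h => le_sSup h, fun h => (T.mul_mono p _ _ h).trans ?_⟩
  rw [imp, T.mul_sSup]
  apply sSup_le
  rintro _ ⟨q, hq, rfl⟩
  exact hq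

/-- The fuzzy inclusion order on `[0,1]^X`. -/
noncomputable def sub {X : Type u} (φ ψ : X → I) : I := ⨅ x, T.imp (φ x) (ψ x)

theorem sub_refl {X : Type u} (φ : X → I) : T.sub φ φ = 1 :=
  le_antisymm le_top (le_iInf fun _ => (T.mul_le_iff _ _ _).1 (T.mul_one _).le)

theorem sub_trans {X : Type u} (φ ψ χ : X → I) :
    T.mul (T.sub ψ χ) (T.sub φ ψ) ≤ T.sub φ χ := by
  refine le_iInf fun x => (T.mul_le_iff _ _ _).1 ?_
  have h1 : T.mul (φ x) (T.sub φ ψ) ≤ ψ x := (T.mul_le_iff _ _ _).2 (iInf_le _ x)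
  have h2 : T.mul (ψ x) (T.sub ψ χ) ≤ χ x := (T.mul_le_iff _ _ _).2 (iInf_le _ x)
  rw [T.mul_comm (T.sub ψ χ), ← T.mul_assoc]
  exact (T.mul_le_mul h1 le_rfl).trans h2

end ContTNorm

/-- A `[0,1]`-order on `X`, valued in the quantale `([0,1], T, 1)`. -/
@[ext]
structure UOrder (T : ContTNorm) (X : Type u) where
  hom : X → X → I
  hom_refl : ∀ x, hom x x = 1
  hom_trans : ∀ x y z, T.mul (hom y z) (hom x y) ≤ hom x z

namespace UOrder

variable {T : ContTNorm} {X Y Z : Type u}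

/-- The opposite `[0,1]`-order. -/
def op (A : UOrder T X) : UOrder T X where
  hom x y := A.hom y x
  hom_refl := A.hom_refl
  hom_trans x y z := by rw [T.mul_comm]; exact A.hom_trans z y x

/-- Isomorphic elements are equal. -/
def Separated (A : UOrder T X) : Prop := ∀ x y, A.hom x y = 1 → A.hom y x = 1 → x = y

/-- A map preserving the `[0,1]`-orders. -/
def Preserves (A : UOrder T X) (B : UOrder T Y) (f : X → Y) : Prop :=
  ∀ x y, A.hom x y ≤ B.hom (f x) (f y)

/-- `f` is left adjoint to `g` (and `g` is right adjoint to `f`). -/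
def Adjoint (A : UOrder T X) (B : UOrder T Y) (f : X → Y) (g : Y → X) : Prop :=
  ∀ x y, B.hom (f x) y = A.hom x (g y)

/-- Weights (lower fuzzy sets) of a `[0,1]`-ordered set. -/
@[ext]
structure Weight (A : UOrder T X) where
  val : X → I
  lower : ∀ x y, T.mul (val y) (A.hom x y) ≤ val x

/-- The Yoneda weight `X(-, a)`. -/
def yoneda (A : UOrder T X) (a : X) : A.Weight where
  val x := A.hom x a
  lower x y := A.hom_trans x y a

/-- The `[0,1]`-ordered set of weights. -/
noncomputable def weights (A : UOrder T X) : UOrder T A.Weight where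
  hom φ ψ := T.sub φ.val ψ.val
  hom_refl φ := T.sub_refl φ.val
  hom_trans φ ψ χ := T.sub_trans φ.val ψ.val χ.val

/-- `a` is a supremum of the weight `φ`. -/
def IsSup (A : UOrder T X) (φ : A.Weight) (a : X) : Prop :=
  ∀ y, A.hom a y = A.weights.hom φ (A.yoneda y)

/-- Every weight has a supremum. -/
def Cocomplete (A : UOrder T X) : Prop := ∀ φ : A.Weight, ∃ a, A.IsSup φ a

/-- The opposite is cocomplete. -/
def Complete (A : UOrder T X) : Prop := A.op.Cocomplete

/-- The direct image `f^→ φ` of a weight along a map. -/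
noncomputable def push (A : UOrder T X) (B : UOrder T Y) (f : X → Y) (φ : A.Weight) :
    B.Weight where
  val y := ⨆ x, T.mul (φ.val x) (B.hom y (f x))
  lower y y' := by
    rw [T.iSup_mul]
    refine iSup_mono fun x => ?_
    rw [T.mul_assoc]
    exact T.mul_mono _ _ _ (B.hom_trans y y' (f x))

/-- A net `x` indexed by a directed set is forward Cauchy. -/
def IsCauchyNet (A : UOrder T X) {ι : Type u} [Preorder ι] (x : ι → X) : Prop :=
  ⨆ i, ⨅ (j) (l) (_ : i ≤ j) (_ : j ≤ l), A.hom (x j) (x l) = 1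

/-- The function `⋁_i ⋀_{j ≥ i} X(-, x_j)` attached to a net `x`. -/
noncomputable def netVal (A : UOrder T X) {ι : Type u} [Preorder ι] (x : ι → X) (a : X) : I :=
  ⨆ i, ⨅ (j) (_ : i ≤ j), A.hom a (x j)

/-- A forward Cauchy weight: one of the form `⋁_i ⋀_{j ≥ i} X(-, x_j)` for some forward Cauchy net
`x` (indexed by a nonempty directed set). -/
def IsCauchyWeight (A : UOrder T X) (φ : A.Weight) : Prop :=
  ∃ (ι : Type u) (_ : Preorder ι) (_ : IsDirectedOrder ι) (_ : Nonempty ι) (x : ι → X),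
    A.IsCauchyNet x ∧ φ.val = A.netVal x

/-- The underlying set of `𝒟X`: forward Cauchy weights. -/
def CauchyWeight (A : UOrder T X) : Type u := {φ : A.Weight // A.IsCauchyWeight φ}

/-- The `[0,1]`-order of `𝒟X`, inherited from the set of weights. -/
noncomputable def cauchyWeights (A : UOrder T X) : UOrder T A.CauchyWeight where
  hom φ ψ := A.weights.hom φ.1 ψ.1
  hom_refl φ := A.weights.hom_refl φ.1
  hom_trans φ ψ χ := A.weights.hom_trans φ.1 ψ.1 χ.1

theorem isCauchyWeight_yoneda (A : UOrder T X) (a : X) : A.IsCauchyWeight (A.yoneda a) := by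
  refine ⟨PUnit, inferInstance, inferInstance, inferInstance, fun _ => a, ?_, ?_⟩
  · simp [IsCauchyNet, A.hom_refl]
  · funext x
    simp [netVal, yoneda]

/-- The Yoneda map `X → 𝒟X`. -/
def cauchyYoneda (A : UOrder T X) (a : X) : A.CauchyWeight :=
  ⟨A.yoneda a, A.isCauchyWeight_yoneda a⟩

/-- There is a string of adjunctions `d ⊣ sup ⊣ y : X → 𝒟X`. -/
def HasDomainString (A : UOrder T X) : Prop :=
  ∃ (d : X → A.CauchyWeight) (s : A.CauchyWeight → X),
    Adjoint A A.cauchyWeights d s ∧ Adjoint A.cauchyWeights A s A.cauchyYoneda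

/-- `A` is a `[0,1]`-domain. -/
def IsDomain (A : UOrder T X) : Prop := A.Separated ∧ A.HasDomainString

/-- `A` is a complete `[0,1]`-lattice. -/
def IsCompleteLattice (A : UOrder T X) : Prop := A.Separated ∧ A.Complete

/-- `A` is a continuous `[0,1]`-lattice. -/
def IsContinuousLattice (A : UOrder T X) : Prop := A.IsCompleteLattice ∧ A.IsDomain

/-- A `[0,1]`-Scott continuous map: it preserves the `[0,1]`-order and all existing suprema of
forward Cauchy weights. -/
def ScottContinuous (A : UOrder T X) (B : UOrder T Y) (f : X → Y) : Prop :=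
  Preserves A B f ∧
    ∀ φ : A.Weight, A.IsCauchyWeight φ → ∀ a, A.IsSup φ a → B.IsSup (push A B f φ) (f a)

theorem IsCauchyNet.map {A : UOrder T X} {B : UOrder T Y} {f : X → Y} (hf : Preserves A B f)
    {ι : Type u} [Preorder ι] {x : ι → X} (hx : A.IsCauchyNet x) : B.IsCauchyNet (f ∘ x) := by
  refine le_antisymm le_top (hx.ge.trans ?_)
  exact iSup_mono fun i => iInf_mono fun j => iInf_mono fun l => iInf_mono fun _ =>
    iInf_mono fun _ => hf _ _

theorem push_val_netVal {A : UOrder T X} {B : UOrder T Y} {f : X → Y} (hf : Preserves A B f)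
    {ι : Type u} [Preorder ι] [IsDirectedOrder ι] {x : ι → X} (hx : A.IsCauchyNet x)
    {φ : A.Weight} (hφ : φ.val = A.netVal x) : (push A B f φ).val = B.netVal (f ∘ x) := by
  funext y
  apply le_antisymm
  · refine iSup_le fun a => ?_
    rw [hφ, netVal, T.iSup_mul]
    refine iSup_mono fun i => le_iInf₂ fun j hij => ?_
    rw [T.mul_comm]
    refine (T.mul_mono _ _ _ ((iInf₂_le j hij).trans (hf _ _))).trans ?_
    rw [T.mul_comm]
    exact B.hom_trans _ _ _
  · refine iSup_le fun i => ?_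
    rw [← T.mul_one (⨅ (j) (_ : i ≤ j), B.hom y ((f ∘ x) j)), ← hx, T.mul_iSup]
    refine iSup_le fun k => ?_
    obtain ⟨m, him, hkm⟩ := exists_ge_ge i k
    refine le_trans ?_ (le_iSup (fun a => T.mul (φ.val a) (B.hom y (f a))) (x m))
    rw [T.mul_comm]
    refine T.mul_le_mul ?_ (iInf₂_le m him)
    rw [hφ]
    refine le_trans ?_ (le_iSup _ m)
    refine le_iInf₂ fun l hl => ?_
    exact (iInf_le _ m).trans ((iInf_le _ l).trans ((iInf_le _ hkm).trans (iInf_le _ hl)))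

theorem IsCauchyWeight.push {A : UOrder T X} {B : UOrder T Y} {f : X → Y} (hf : Preserves A B f)
    {φ : A.Weight} (hφ : A.IsCauchyWeight φ) : B.IsCauchyWeight (push A B f φ) := by
  obtain ⟨ι, _, _, _, x, hx, h⟩ := hφ
  exact ⟨ι, inferInstance, inferInstance, inferInstance, f ∘ x, hx.map hf,
    push_val_netVal hf hx h⟩

theorem push_id {A : UOrder T X} {φ : A.Weight} (hφ : A.IsCauchyWeight φ) :
    push A A id φ = φ := by
  obtain ⟨ι, _, _, _, x, hx, h⟩ := hφ
  ext1
  rw [push_val_netVal (f := id) (fun _ _ => le_rfl) hx h, h]; rfl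

theorem push_comp {A : UOrder T X} {B : UOrder T Y} {C : UOrder T Z} {f : X → Y} {g : Y → Z}
    (hf : Preserves A B f) (hg : Preserves B C g) {φ : A.Weight} (hφ : A.IsCauchyWeight φ) :
    push B C g (push A B f φ) = push A C (g ∘ f) φ := by
  obtain ⟨ι, _, _, _, x, hx, h⟩ := hφ
  ext1
  rw [push_val_netVal hg (hx.map hf) (push_val_netVal hf hx h),
    push_val_netVal (f := g ∘ f) (fun a b => (hf a b).trans (hg _ _)) hx h]; rfl

theorem ScottContinuous.id (A : UOrder T X) : ScottContinuous A A id :=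
  ⟨fun _ _ => le_rfl, fun φ hφ a ha => by rw [push_id hφ]; exact ha⟩

theorem ScottContinuous.comp {A : UOrder T X} {B : UOrder T Y} {C : UOrder T Z} {f : X → Y}
    {g : Y → Z} (hg : ScottContinuous B C g) (hf : ScottContinuous A B f) :
    ScottContinuous A C (g ∘ f) :=
  ⟨fun a b => (hf.1 a b).trans (hg.1 _ _), fun φ hφ a ha => by
    rw [← push_comp hf.1 hg.1 hφ]
    exact hg.2 _ (hφ.push hf.1) _ (hf.2 φ hφ a ha)⟩

end UOrder

/-- Continuous `[0,1]`-lattices for the continuous t-norm `T`. -/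
structure ConLat (T : ContTNorm) where
  carrier : Type u
  order : UOrder T carrier
  isContinuousLattice : order.IsContinuousLattice

namespace ConLat

variable {T : ContTNorm}

/-- Morphisms of continuous `[0,1]`-lattices: `[0,1]`-Scott continuous right adjoints. -/
@[ext]
structure Hom (A B : ConLat.{u} T) where
  toFun : A.carrier → B.carrier
  scottContinuous : UOrder.ScottContinuous A.order B.order toFun
  isRightAdjoint : ∃ l : B.carrier → A.carrier, UOrder.Adjoint B.order A.order l toFun

instance : Category.{u} (ConLat.{u} T) where
  Hom := Hom
  id A := ⟨id, UOrder.ScottContinuous.id A.order, id, fun _ _ => rfl⟩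
  comp f g := ⟨g.toFun ∘ f.toFun, g.scottContinuous.comp f.scottContinuous, by
    obtain ⟨l, hl⟩ := f.isRightAdjoint
    obtain ⟨m, hm⟩ := g.isRightAdjoint
    exact ⟨l ∘ m, fun x y => (hl (m x) y).trans (hm x _)⟩⟩

/-- The forgetful functor from continuous `[0,1]`-lattices to sets. -/
def forgetful (T : ContTNorm) : ConLat.{u} T ⥤ Type u where
  obj A := A.carrier
  map f := TypeCat.ofHom (Hom.toFun f)

end ConLat

/-! The proof is Beck's monadicity theorem together with an explicit free object. The set `[0,1]^X`
with opposite fuzzy inclusion is freely generated by `X` under weighted infima, and `𝒟` freely adds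
suprema of Cauchy weights, so `𝒟(([0,1]^X)ᵒᵖ)` is the candidate. Any `𝒟A` has the string `d ⊣ sup ⊣
y`; the hard point is completeness. Over this base, Cauchy weights are exactly the fuzzy filters:
the value at the constant `1` is `1`, binary meets are respected, and `s → μ` has value `1` when `s
< φ(μ)`. Condition (S) enters only here, to make such filters stable under weighted infima
(`isCauchyWeight_infWeight`).

For Beck's conditions, a continuous lattice is seen as a set with total operations: weighted infima
and limits inferior of arbitrary nets. Morphisms preserve both, so the kernel of a split coequalizer
is a congruence for them. Infima of fibres then embed the quotient in the original lattice as a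
coreflective retract (`exists_quotient_of_split`), which is again a continuous lattice.

Bijectivity on objects holds because structure transports along bijections and algebra morphisms
recover the order. -/

namespace ContTNorm

variable (T : ContTNorm)

/-! ### Residuation and the use of condition (S) -/

theorem le_imp_iff {p q r : I} : q ≤ T.imp p r ↔ T.mul p q ≤ r := (T.mul_le_iff p q r).symm

theorem mul_imp_le (p r : I) : T.mul p (T.imp p r) ≤ r := T.le_imp_iff.1 le_rfl

theorem mul_left_comm (p q r : I) : T.mul p (T.mul q r) = T.mul q (T.mul p r) := by
  rw [← T.mul_assoc, T.mul_comm p q, T.mul_assoc]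

theorem zero_mul (p : I) : T.mul 0 p = 0 := le_antisymm (T.mul_le_left 0 p) bot_le

theorem imp_eq_one_iff {p r : I} : T.imp p r = 1 ↔ p ≤ r := by
  have h : (1 : I) ≤ T.imp p r ↔ p ≤ r := by rw [T.le_imp_iff, T.mul_one]
  exact ⟨fun e => h.1 e.ge, fun e => le_antisymm le_top (h.2 e)⟩

theorem one_imp (r : I) : T.imp 1 r = r :=
  eq_of_forall_le_iff fun c => by rw [T.le_imp_iff, T.one_mul]

theorem zero_imp (r : I) : T.imp 0 r = 1 := T.imp_eq_one_iff.2 bot_le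

theorem imp_mono {p r r' : I} (h : r ≤ r') : T.imp p r ≤ T.imp p r' :=
  T.le_imp_iff.2 ((T.mul_imp_le p r).trans h)

theorem le_sub_iff {X : Type*} {φ ψ : X → I} {t : I} :
    t ≤ T.sub φ ψ ↔ ∀ x, T.mul (φ x) t ≤ ψ x := by
  simp only [sub, le_iInf_iff, T.le_imp_iff]

theorem mul_sub_le {X : Type*} (φ ψ : X → I) (x : X) : T.mul (φ x) (T.sub φ ψ) ≤ ψ x :=
  T.le_sub_iff.1 le_rfl x

theorem sub_eq_one_iff {X : Type*} {φ ψ : X → I} : T.sub φ ψ = 1 ↔ ∀ x, φ x ≤ ψ x := by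
  have h : (1 : I) ≤ T.sub φ ψ ↔ ∀ x, φ x ≤ ψ x := by simp only [T.le_sub_iff, T.mul_one]
  exact ⟨fun e => h.1 e.ge, fun e => le_antisymm le_top (h.2 e)⟩

/-- Any number is the supremum of its multiples by numbers below `1`. -/
theorem le_of_forall_mul_le {r c : I} (h : ∀ t < 1, T.mul r t ≤ c) : r ≤ c := by
  have h1 : sSup (Set.Iio (1 : I)) = 1 := by
    refine le_antisymm le_top (le_of_forall_lt fun c hc => ?_)
    obtain ⟨d, hcd, hd⟩ := exists_between hc
    exact hcd.trans_le (le_sSup hd)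
  rw [← T.mul_one r, ← h1, T.mul_sSup]
  apply sSup_le
  rintro _ ⟨t, ht, rfl⟩
  exact h t ht

theorem exists_lt_mul {r c : I} (h : c < r) : ∃ t < 1, c < T.mul r t := by
  by_contra! H
  exact absurd (T.le_of_forall_mul_le H) h.not_ge

/-- The consequence of condition (S) used for cotensors of Cauchy weights. -/
theorem CondS.mul_lt_of_lt_imp (hS : T.CondS) {q q' s c : I} (hc : 0 < c) (hq : q' < q)
    (hs : s < T.imp q c) : T.mul q' s < c := by
  rcases eq_or_ne q c with rfl | hne
  · exact (T.mul_le_left q' s).trans_lt hq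
  have hcont : ContinuousAt (fun z => T.imp q z) c :=
    (hS (q, c) hne).comp (f := fun z => (q, z)) (Continuous.prodMk_right q).continuousAt
  have hev : ∀ᶠ z in nhds c, s < T.imp q z := hcont.eventually (lt_mem_nhds hs)
  -- Continuity at `c > 0` allows `c` to be lowered to some `d < c` with `s < q → d` still true;
  -- then `q & s ≤ d < c`.
  obtain ⟨l, hl, hsub⟩ := exists_Ioc_subset_of_mem_nhds hev ⟨0, hc⟩
  obtain ⟨d, hld, hdc⟩ := exists_between hl
  have hd : s < T.imp q d := hsub ⟨hld, hdc.le⟩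
  exact ((T.mul_le_mul hq.le le_rfl).trans (T.le_imp_iff.1 hd.le)).trans_lt hdc

end ContTNorm

/-! ### Weighted suprema and infima, adjunctions, direct images -/

namespace UOrder

variable {T : ContTNorm} {X Y Z : Type u}

/-- `a` is the supremum of the family `f` weighted by `w`. -/
def IsSupFam (A : UOrder T X) {ι : Type*} (w : ι → I) (f : ι → X) (a : X) : Prop :=
  ∀ y, A.hom a y = T.sub w fun i => A.hom (f i) y

/-- `a` is the infimum of the family `f` weighted by `w`. -/
def IsInfFam (A : UOrder T X) {ι : Type*} (w : ι → I) (f : ι → X) (a : X) : Prop :=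
  ∀ y, A.hom y a = T.sub w fun i => A.hom y (f i)

theorem hom_trans' (A : UOrder T X) (x y z : X) : T.mul (A.hom x y) (A.hom y z) ≤ A.hom x z := by
  rw [T.mul_comm]; exact A.hom_trans x y z

theorem hom_le_hom_left {A : UOrder T X} {x y : X} (h : A.hom x y = 1) (z : X) :
    A.hom y z ≤ A.hom x z := by
  simpa only [h, T.one_mul] using A.hom_trans' x y z

theorem hom_le_hom_right {A : UOrder T X} {x y : X} (h : A.hom x y = 1) (z : X) :
    A.hom z x ≤ A.hom z y := by
  simpa only [h, T.one_mul] using A.hom_trans z x y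

theorem hom_eq_one_of_le {A : UOrder T X} {x y : X} (h : A.hom x x ≤ A.hom x y) :
    A.hom x y = 1 := le_antisymm le_top (by rwa [A.hom_refl] at h)

theorem Separated.eq_of_hom_left {A : UOrder T X} (hA : A.Separated) {a b : X}
    (h : ∀ y, A.hom a y = A.hom b y) : a = b :=
  hA a b (by rw [h, A.hom_refl]) (by rw [← h, A.hom_refl])

theorem Separated.eq_of_hom_right {A : UOrder T X} (hA : A.Separated) {a b : X}
    (h : ∀ y, A.hom y a = A.hom y b) : a = b :=
  hA a b (by rw [← h, A.hom_refl]) (by rw [h, A.hom_refl])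

theorem IsInfFam.mul_hom_le {A : UOrder T X} {ι : Type*} {w : ι → I} {f : ι → X} {a : X}
    (ha : A.IsInfFam w f a) (y : X) (i : ι) : T.mul (w i) (A.hom y a) ≤ A.hom y (f i) := by
  rw [ha y]
  exact T.mul_sub_le w (fun i => A.hom y (f i)) i

theorem IsSupFam.unique {A : UOrder T X} (hA : A.Separated) {ι : Type*} {w : ι → I} {f : ι → X}
    {a b : X} (ha : A.IsSupFam w f a) (hb : A.IsSupFam w f b) : a = b :=
  hA.eq_of_hom_left fun y => (ha y).trans (hb y).symm

theorem IsInfFam.unique {A : UOrder T X} (hA : A.Separated) {ι : Type*} {w : ι → I} {f : ι → X}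
    {a b : X} (ha : A.IsInfFam w f a) (hb : A.IsInfFam w f b) : a = b :=
  hA.eq_of_hom_right fun y => (ha y).trans (hb y).symm

/-- The upper closure of a weighted family is a weight of the opposite with the same infima, so the
index type may lie in any universe. -/
theorem Complete.exists_isInfFam {A : UOrder T X} (hA : A.Complete) {ι : Type*} (w : ι → I)
    (f : ι → X) : ∃ a, A.IsInfFam w f a := by
  obtain ⟨a, ha⟩ := hA
    { val := fun x => ⨆ i, T.mul (w i) (A.hom (f i) x)
      lower := fun x y => by
        rw [T.iSup_mul]
        refine iSup_mono fun i => ?_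
        rw [T.mul_assoc]
        exact T.mul_mono _ _ _ (A.hom_trans' _ _ _) }
  refine ⟨a, fun y => (ha y).trans (eq_of_forall_le_iff fun t => ?_)⟩
  refine T.le_sub_iff.trans (Iff.trans ?_ T.le_sub_iff.symm)
  constructor
  · intro h i
    refine (T.mul_le_mul ?_ le_rfl).trans (h (f i))
    refine le_trans ?_ (le_iSup _ i)
    rw [A.hom_refl, T.mul_one]
  · intro h x
    rw [T.iSup_mul]
    refine iSup_le fun i => ?_
    rw [T.mul_comm (w i), T.mul_assoc, T.mul_comm]
    exact (T.mul_le_mul (h i) le_rfl).trans (A.hom_trans' y (f i) x)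

theorem complete_of_exists_isInfFam {A : UOrder T X}
    (h : ∀ w : X → I, ∃ a, A.IsInfFam w id a) : A.Complete := fun φ => h φ.val

/-- Direct image is left adjoint to precomposition with `f`. This reduces every supremum of a pushed
weight to a weighted family. -/
theorem sub_push (A : UOrder T X) (B : UOrder T Y) (f : X → Y) (φ : A.Weight) (ψ : B.Weight) :
    T.sub (push A B f φ).val ψ.val = T.sub φ.val fun x => ψ.val (f x) := by
  refine eq_of_forall_le_iff fun t => ?_
  rw [T.le_sub_iff, T.le_sub_iff]
  constructor
  · intro h x
    refine (T.mul_le_mul ?_ le_rfl).trans (h (f x))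
    refine le_trans ?_ (le_iSup _ x)
    rw [B.hom_refl, T.mul_one]
  · intro h y
    refine (T.iSup_mul t _).trans_le (iSup_le fun x => ?_)
    rw [T.mul_assoc, T.mul_comm (B.hom y _), ← T.mul_assoc]
    exact (T.mul_le_mul (h x) le_rfl).trans (ψ.lower y (f x))

theorem isSup_push_iff {A : UOrder T X} {B : UOrder T Y} {f : X → Y} {φ : A.Weight} {b : Y} :
    B.IsSup (push A B f φ) b ↔ B.IsSupFam φ.val f b :=
  forall_congr' fun y => by
    change B.hom b y = T.sub (push A B f φ).val (B.yoneda y).val ↔ _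
    rw [sub_push]; rfl

theorem Adjoint.preserves_left {A : UOrder T X} {B : UOrder T Y} {f : X → Y} {g : Y → X}
    (h : Adjoint A B f g) : Preserves A B f := fun x y => by
  rw [h x]
  exact A.hom_le_hom_right (by rw [← h, B.hom_refl]) x

theorem Adjoint.preserves_right {A : UOrder T X} {B : UOrder T Y} {f : X → Y} {g : Y → X}
    (h : Adjoint A B f g) : Preserves B A g := fun x y => by
  rw [← h]
  exact B.hom_le_hom_left (by rw [h, A.hom_refl]) y

theorem Adjoint.isSupFam {A : UOrder T X} {B : UOrder T Y} {f : X → Y} {g : Y → X}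
    (h : Adjoint A B f g) {ι : Type*} {w : ι → I} {x : ι → X} {a : X} (ha : A.IsSupFam w x a) :
    B.IsSupFam w (f ∘ x) (f a) := fun y => by
  rw [h, ha]; simp only [Function.comp, h _ y]

theorem Adjoint.isInfFam {A : UOrder T X} {B : UOrder T Y} {f : X → Y} {g : Y → X}
    (h : Adjoint A B f g) {ι : Type*} {w : ι → I} {x : ι → Y} {a : Y} (ha : B.IsInfFam w x a) :
    A.IsInfFam w (g ∘ x) (g a) := fun y => by
  rw [← h, ha]; simp only [Function.comp, h y _]

theorem push_adjoint {A : UOrder T X} {B : UOrder T Y} {f : X → Y} {g : Y → X}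
    (h : Adjoint A B f g) (φ : A.Weight) (ψ : B.Weight) :
    B.weights.hom (push A B f φ) ψ = A.weights.hom φ (push B A g ψ) := by
  refine (sub_push A B f φ ψ).trans ?_
  suffices hψ : (fun x => ψ.val (f x)) = (push B A g ψ).val by rw [hψ]; rfl
  funext x
  apply le_antisymm
  · refine le_trans ?_ (le_iSup _ (f x))
    rw [← h, B.hom_refl, T.mul_one]
  · refine iSup_le fun y => ?_
    rw [← h]
    exact ψ.lower _ _

/-- The direct image of a Cauchy weight along an order preserving map. -/
noncomputable def cauchyPush {A : UOrder T X} {B : UOrder T Y} {f : X → Y} (hf : Preserves A B f)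
    (φ : A.CauchyWeight) : B.CauchyWeight := ⟨push A B f φ.1, φ.2.push hf⟩

theorem cauchyPush_adjoint {A : UOrder T X} {B : UOrder T Y} {f : X → Y} {g : Y → X}
    (h : Adjoint A B f g) : Adjoint A.cauchyWeights B.cauchyWeights
      (cauchyPush h.preserves_left) (cauchyPush h.preserves_right) :=
  fun φ ψ => push_adjoint h φ.1 ψ.1

theorem preserves_cauchyPush {A : UOrder T X} {B : UOrder T Y} {f : X → Y} (hf : Preserves A B f) :
    Preserves A.cauchyWeights B.cauchyWeights (cauchyPush hf) := fun φ ψ => by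
  refine le_trans ?_ (sub_push A B f φ.1 (push A B f ψ.1)).ge
  refine le_iInf fun x => (iInf_le _ x).trans (T.imp_mono ?_)
  refine le_trans ?_ (le_iSup _ x)
  rw [B.hom_refl, T.mul_one]

theorem separated_weights (A : UOrder T X) : A.weights.Separated := fun _ _ h h' =>
  Weight.ext (funext fun x =>
    le_antisymm (T.sub_eq_one_iff.1 h x) (T.sub_eq_one_iff.1 h' x))

theorem separated_cauchyWeights (A : UOrder T X) : A.cauchyWeights.Separated := fun φ ψ h h' =>
  Subtype.ext (A.separated_weights φ.1 ψ.1 h h')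

theorem weights_hom_yoneda (A : UOrder T X) (a : X) (φ : A.Weight) :
    A.weights.hom (A.yoneda a) φ = φ.val a := by
  refine eq_of_forall_le_iff fun t => T.le_sub_iff.trans ⟨fun h => ?_, fun h x => ?_⟩
  · simpa only [yoneda, A.hom_refl, T.one_mul] using h a
  · rw [T.mul_comm]
    exact (T.mul_le_mul h le_rfl).trans (φ.lower x a)

theorem isSup_yoneda (A : UOrder T X) (a : X) : A.IsSup (A.yoneda a) a := fun y =>
  (A.weights_hom_yoneda a (A.yoneda y)).symm

theorem preserves_yoneda (A : UOrder T X) : Preserves A A.cauchyWeights A.cauchyYoneda :=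
  fun x y => (A.weights_hom_yoneda x (A.yoneda y)).ge

theorem Adjoint.isSup {A : UOrder T X} {s : A.CauchyWeight → X}
    (h : Adjoint A.cauchyWeights A s A.cauchyYoneda) (φ : A.CauchyWeight) : A.IsSup φ.1 (s φ) :=
  fun y => h φ y

theorem adjoint_cauchyYoneda {A : UOrder T X} {s : A.CauchyWeight → X}
    (h : ∀ φ, A.IsSup φ.1 (s φ)) : Adjoint A.cauchyWeights A s A.cauchyYoneda := h

theorem HasDomainString.exists_isSup {A : UOrder T X} (h : A.HasDomainString) {φ : A.Weight}
    (hφ : A.IsCauchyWeight φ) : ∃ a, A.IsSup φ a := by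
  obtain ⟨_, s, _, hs⟩ := h
  exact ⟨s ⟨φ, hφ⟩, hs.isSup ⟨φ, hφ⟩⟩

/-! ### A criterion for Cauchy weights -/

/-- A point far enough along the net serves as `z`. This is fuzzy directedness of `φ`, and it frees
later arguments from nets. -/
theorem IsCauchyWeight.exists_lt {A : UOrder T X} {φ : A.Weight} (hφ : A.IsCauchyWeight φ)
    {x y : X} {r s t : I} (hr : r < φ.val x) (hs : s < φ.val y) (ht : t < 1) :
    ∃ z, t < φ.val z ∧ r < A.hom x z ∧ s < A.hom y z := by
  obtain ⟨ι, _, _, _, n, hn, hv⟩ := hφ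
  rw [hv] at hr hs ⊢
  obtain ⟨i, hi⟩ := lt_iSup_iff.1 hr
  obtain ⟨j, hj⟩ := lt_iSup_iff.1 hs
  obtain ⟨k, hk⟩ := lt_iSup_iff.1 (ht.trans_eq hn.symm)
  obtain ⟨m, him, hjm⟩ := exists_ge_ge i j
  obtain ⟨l, hml, hkl⟩ := exists_ge_ge m k
  refine ⟨n l, hk.trans_le (le_iSup_of_le l ?_), hi.trans_le (iInf₂_le l (him.trans hml)),
    hj.trans_le (iInf₂_le l (hjm.trans hml))⟩
  refine le_iInf₂ fun p hp => ?_
  exact (iInf_le _ l).trans ((iInf_le _ p).trans ((iInf_le _ hkl).trans (iInf_le _ hp)))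

theorem IsCauchyWeight.exists_lt_val {A : UOrder T X} {φ : A.Weight} (hφ : A.IsCauchyWeight φ)
    {t : I} (ht : t < 1) : ∃ z, t < φ.val z := by
  obtain ⟨ι, _, _, _, n, hn, hv⟩ := hφ
  obtain ⟨k, hk⟩ := lt_iSup_iff.1 (ht.trans_eq hn.symm)
  refine ⟨n k, hk.trans_le ?_⟩
  rw [hv]
  refine le_iSup_of_le k (le_iInf₂ fun p hp => ?_)
  exact (iInf_le _ k).trans ((iInf_le _ p).trans ((iInf_le _ le_rfl).trans (iInf_le _ hp)))

/-- Conversely, a fuzzy directed weight is represented by the net of its own points `(x, r)` with `r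
< φ(x)`. -/
theorem isCauchyWeight_of_exists_lt {A : UOrder T X} {φ : A.Weight}
    (h1 : ∀ t < 1, ∃ z, t < φ.val z)
    (h2 : ∀ x y : X, ∀ r s t : I, r < φ.val x → s < φ.val y → t < 1 →
      ∃ z, t < φ.val z ∧ r < A.hom x z ∧ s < A.hom y z) : A.IsCauchyWeight φ := by
  let ι : Type u := {p : X × I // p.2 < φ.val p.1}
  -- The product yields both `r ≤ A(x,y)` and `r ≤ s` for `(x,r) ≤ (y,s)`, and stays transitive by
  -- associativity.
  let _ : Preorder ι :=
    { le := fun p q => p.1.2 ≤ T.mul (A.hom p.1.1 q.1.1) q.1.2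
      le_refl := fun p => by rw [A.hom_refl, T.one_mul]
      le_trans := fun p q r hpq hqr => by
        refine hpq.trans ((T.mul_mono _ _ _ hqr).trans ?_)
        rw [← T.mul_assoc]
        exact T.mul_le_mul (A.hom_trans' _ _ _) le_rfl }
  have hle : ∀ {p q : ι}, p ≤ q → p.1.2 ≤ A.hom p.1.1 q.1.1 := fun h =>
    le_trans h (T.mul_le_left _ _)
  have hle' : ∀ {p q : ι}, p ≤ q → p.1.2 ≤ q.1.2 := fun h =>
    le_trans h (T.mul_le_right _ _)
  -- Besides directedness, the second coordinates can be pushed arbitrarily close to `1`.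
  have hdir : ∀ (p q : ι) (t : I), t < 1 → ∃ c : ι, p ≤ c ∧ q ≤ c ∧ t < c.1.2 := by
    rintro ⟨⟨x, r⟩, hr⟩ ⟨⟨y, s⟩, hs⟩ t ht
    obtain ⟨r', hrr', hr'⟩ := exists_between hr
    obtain ⟨s', hss', hs'⟩ := exists_between hs
    obtain ⟨t₁, ht₁, hrt⟩ := T.exists_lt_mul hrr'
    obtain ⟨t₂, ht₂, hst⟩ := T.exists_lt_mul hss'
    obtain ⟨t', ht', ht'1⟩ := exists_between (max_lt (max_lt ht₁ ht₂) ht)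
    obtain ⟨z, hz, hxz, hyz⟩ := h2 x y r' s' t' hr' hs' ht'1
    refine ⟨⟨(z, t'), hz⟩, ?_, ?_, (le_max_right _ _).trans_lt ht'⟩
    · exact hrt.le.trans (T.mul_le_mul hxz.le (((le_max_left _ _).trans (le_max_left _ _)).trans
        ht'.le))
    · exact hst.le.trans (T.mul_le_mul hyz.le (((le_max_right _ _).trans (le_max_left _ _)).trans
        ht'.le))
  refine ⟨ι, inferInstance, ⟨fun p q => ?_⟩, ?_, fun p => p.1.1, ?_, ?_⟩
  · obtain ⟨c, hp, hq, _⟩ := hdir p q 0 zero_lt_one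
    exact ⟨c, hp, hq⟩
  · obtain ⟨z, hz⟩ := h1 0 zero_lt_one
    exact ⟨⟨(z, 0), hz⟩⟩
  · refine le_antisymm le_top (le_of_forall_lt fun t ht => ?_)
    obtain ⟨t', htt', ht'⟩ := exists_between ht
    obtain ⟨z, hz⟩ := h1 t' ht'
    refine htt'.trans_le (le_iSup_of_le (⟨(z, t'), hz⟩ : ι) ?_)
    refine le_iInf fun j => le_iInf fun l => le_iInf fun hj => le_iInf fun hl => ?_
    exact (hle' hj).trans (hle hl)
  · funext a
    apply le_antisymm
    · refine le_of_forall_lt fun r hr => ?_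
      obtain ⟨r', hrr', hr'⟩ := exists_between hr
      refine hrr'.trans_le (le_iSup_of_le (⟨(a, r'), hr'⟩ : ι) ?_)
      exact le_iInf₂ fun j hj => hle hj
    · refine iSup_le fun i => T.le_of_forall_mul_le fun t ht => ?_
      obtain ⟨c, hic, _, htc⟩ := hdir i i t ht
      rw [T.mul_comm]
      exact (T.mul_le_mul (htc.trans c.2).le (iInf₂_le c hic)).trans (φ.lower a c.1.1)

end UOrder

namespace UOrder

variable {T : ContTNorm} {X Y Z : Type u}

theorem cauchyWeights_hom_yoneda (A : UOrder T X) (a : X) (φ : A.CauchyWeight) :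
    A.cauchyWeights.hom (A.cauchyYoneda a) φ = φ.1.val a := A.weights_hom_yoneda a φ.1

/-! ### Cauchy weights form a domain -/

theorem mul_val_le_val_yoneda {A : UOrder T X} (Φ : A.cauchyWeights.Weight) (φ : A.CauchyWeight)
    (a : X) : T.mul (Φ.val φ) (φ.1.val a) ≤ Φ.val (A.cauchyYoneda a) := by
  rw [← cauchyWeights_hom_yoneda]; exact Φ.lower _ _

/-- The supremum of a weight of Cauchy weights, as a weight. -/
noncomputable def joinWeight {A : UOrder T X} (Φ : A.cauchyWeights.Weight) : A.Weight where
  val a := Φ.val (A.cauchyYoneda a)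
  lower x y := (T.mul_mono _ _ _ (A.preserves_yoneda x y)).trans (Φ.lower _ _)

theorem isCauchyWeight_joinWeight {A : UOrder T X} {Φ : A.cauchyWeights.Weight}
    (hΦ : A.cauchyWeights.IsCauchyWeight Φ) : A.IsCauchyWeight (joinWeight Φ) := by
  have key : ∀ t < 1, ∃ t' < 1, ∃ t'' < 1, t < T.mul t' t'' := fun t ht => by
    obtain ⟨t', h, h'⟩ := exists_between ht
    obtain ⟨t'', h'', h3⟩ := T.exists_lt_mul h
    exact ⟨t', h', t'', h'', h3⟩
  refine isCauchyWeight_of_exists_lt (fun t ht => ?_) fun x y r s t hr hs ht => ?_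
  · obtain ⟨t', ht', t'', ht'', h⟩ := key t ht
    obtain ⟨ψ, hψ⟩ := hΦ.exists_lt_val ht'
    obtain ⟨z, hz⟩ := ψ.2.exists_lt_val ht''
    exact ⟨z, h.trans_le ((T.mul_le_mul hψ.le hz.le).trans (mul_val_le_val_yoneda Φ ψ z))⟩
  · obtain ⟨t', ht', t'', ht'', h⟩ := key t ht
    obtain ⟨ψ, hψ, hx, hy⟩ := hΦ.exists_lt hr hs ht'
    rw [cauchyWeights_hom_yoneda] at hx hy
    obtain ⟨z, hz, hxz, hyz⟩ := ψ.2.exists_lt hx hy ht''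
    exact ⟨z, h.trans_le ((T.mul_le_mul hψ.le hz.le).trans (mul_val_le_val_yoneda Φ ψ z)),
      hxz, hyz⟩

/-- The supremum of a Cauchy weight of Cauchy weights. -/
noncomputable def cauchyJoin (A : UOrder T X) (Φ : A.cauchyWeights.CauchyWeight) :
    A.CauchyWeight := ⟨joinWeight Φ.1, isCauchyWeight_joinWeight Φ.2⟩

theorem isSup_cauchyJoin (A : UOrder T X) (Φ : A.cauchyWeights.CauchyWeight) :
    A.cauchyWeights.IsSup Φ.1 (A.cauchyJoin Φ) := fun ψ => eq_of_forall_le_iff fun t => by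
  refine T.le_sub_iff.trans (Iff.trans ?_ T.le_sub_iff.symm)
  constructor
  · intro h φ
    refine T.le_sub_iff.2 fun a => ?_
    rw [← T.mul_assoc, T.mul_comm (φ.1.val a)]
    exact (T.mul_le_mul (mul_val_le_val_yoneda Φ.1 φ a) le_rfl).trans (h a)
  · intro h a
    exact (h (A.cauchyYoneda a)).trans (A.weights_hom_yoneda a ψ.1).le

/-- The join of `Φ` is `Φ ∘ y`, that is, precomposition with Yoneda, so its left adjoint is direct
image along Yoneda. -/
theorem hasDomainString_cauchyWeights (A : UOrder T X) : A.cauchyWeights.HasDomainString := by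
  refine ⟨cauchyPush A.preserves_yoneda, A.cauchyJoin, fun φ Φ => ?_,
    adjoint_cauchyYoneda A.isSup_cauchyJoin⟩
  exact sub_push A A.cauchyWeights A.cauchyYoneda φ.1 Φ.1

theorem isSup_push_yoneda (A : UOrder T X) (φ : A.CauchyWeight) :
    A.cauchyWeights.IsSup (push A A.cauchyWeights A.cauchyYoneda φ.1) φ := by
  refine isSup_push_iff.2 fun ψ => ?_
  simp only [cauchyWeights_hom_yoneda]
  rfl

/-! ### The opposite of a power of the unit interval -/

/-- The set of functions `X → [0,1]` with the opposite of the fuzzy inclusion order. -/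
noncomputable def powerOp (T : ContTNorm) (X : Type u) : UOrder T (X → I) where
  hom μ ν := T.sub ν μ
  hom_refl μ := T.sub_refl μ
  hom_trans μ ν ξ := by rw [T.mul_comm]; exact T.sub_trans ξ ν μ

theorem le_powerOp_hom {μ ν : X → I} {t : I} :
    t ≤ (powerOp T X).hom μ ν ↔ ∀ x, T.mul (ν x) t ≤ μ x := T.le_sub_iff

theorem powerOp_hom_imp (s : I) (μ ν : X → I) :
    (powerOp T X).hom (fun x => T.imp s (μ x)) ν = T.imp s ((powerOp T X).hom μ ν) :=
  eq_of_forall_le_iff fun t => by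
    simp only [T.le_imp_iff, le_powerOp_hom, T.mul_left_comm]

theorem powerOp_hom_inf (μ μ' ν : X → I) : (powerOp T X).hom (fun x => μ x ⊓ μ' x) ν =
    (powerOp T X).hom μ ν ⊓ (powerOp T X).hom μ' ν :=
  eq_of_forall_le_iff fun t => by
    simp only [le_inf_iff, le_powerOp_hom, forall_and]

theorem powerOp_one_hom (ν : X → I) : (powerOp T X).hom (fun _ => 1) ν = 1 :=
  T.sub_eq_one_iff.2 fun _ => le_top

/-- The constant `1` is the bottom of the opposite power. -/
theorem IsCauchyWeight.val_one {φ : (powerOp T X).Weight} (hφ : (powerOp T X).IsCauchyWeight φ) :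
    φ.val (fun _ => 1) = 1 := by
  refine le_antisymm le_top (le_of_forall_lt fun t ht => ?_)
  obtain ⟨z, hz⟩ := hφ.exists_lt_val ht
  refine hz.trans_le ?_
  have h := φ.lower (fun _ => 1) z
  rwa [powerOp_one_hom, T.mul_one] at h

/-- Pointwise meets are binary joins in the opposite order, and fuzzy directedness supplies
approximate upper bounds. -/
theorem IsCauchyWeight.val_inf {φ : (powerOp T X).Weight} (hφ : (powerOp T X).IsCauchyWeight φ)
    {μ ν : X → I} {r : I} (hμ : r ≤ φ.val μ) (hν : r ≤ φ.val ν) :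
    r ≤ φ.val (fun x => μ x ⊓ ν x) := by
  refine le_of_forall_lt fun r' hr' => ?_
  obtain ⟨c, hrc, hc⟩ := exists_between hr'
  refine hrc.trans_le (T.le_of_forall_mul_le fun t ht => ?_)
  obtain ⟨z, hz, h1, h2⟩ := hφ.exists_lt (hc.trans_le hμ) (hc.trans_le hν) ht
  rw [T.mul_comm]
  refine (T.mul_le_mul hz.le ?_).trans (φ.lower _ z)
  rw [powerOp_hom_inf]
  exact le_inf h1.le h2.le

theorem IsCauchyWeight.val_imp_eq_one {φ : (powerOp T X).Weight}
    (hφ : (powerOp T X).IsCauchyWeight φ) {μ : X → I} {s : I} (hs : s < φ.val μ) :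
    φ.val (fun x => T.imp s (μ x)) = 1 := by
  refine le_antisymm le_top (le_of_forall_lt fun t ht => ?_)
  obtain ⟨z, hz, h1, _⟩ := hφ.exists_lt hs hs ht
  refine hz.trans_le ?_
  have h := φ.lower (fun x => T.imp s (μ x)) z
  rwa [powerOp_hom_imp, T.imp_eq_one_iff.2 h1.le, T.mul_one] at h

/-- For `q' < q`, (S) gives the strict inequality `q' & s < φ(μ)`, so `(q' & s) → μ` has value `1`;
and `s → μ` is below it to degree at least `q'`. If `φ(μ) = 0`, where (S) gives nothing strict, `q'
& s` vanishes. -/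
theorem IsCauchyWeight.le_val_imp (hS : T.CondS) {φ : (powerOp T X).Weight}
    (hφ : (powerOp T X).IsCauchyWeight φ) {μ : X → I} {q s : I} (hs : s < T.imp q (φ.val μ)) :
    q ≤ φ.val (fun x => T.imp s (μ x)) := by
  refine le_of_forall_lt fun p hp => ?_
  obtain ⟨q', hpq, hq⟩ := exists_between hp
  refine hpq.trans_le ?_
  have hone : φ.val (fun x => T.imp (T.mul q' s) (μ x)) = 1 := by
    rcases eq_or_ne (φ.val μ) 0 with h0 | h0
    · have h : T.mul q' s = 0 := by
        refine le_antisymm ?_ bot_le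
        rw [← h0]
        exact (T.mul_le_mul hq.le le_rfl).trans (T.le_imp_iff.1 hs.le)
      simp only [h, T.zero_imp]
      exact hφ.val_one
    · exact hφ.val_imp_eq_one
        (ContTNorm.CondS.mul_lt_of_lt_imp T hS (lt_of_le_of_ne bot_le h0.symm) hq hs)
  have h := φ.lower (fun x => T.imp s (μ x)) (fun x => T.imp (T.mul q' s) (μ x))
  rw [hone, T.one_mul] at h
  refine le_trans (le_powerOp_hom.2 fun x => T.le_imp_iff.2 ?_) h
  rw [T.mul_comm _ q', T.mul_left_comm, ← T.mul_assoc]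
  exact T.mul_imp_le _ _

theorem isCauchyWeight_powerOp {φ : (powerOp T X).Weight} (h1 : φ.val (fun _ => 1) = 1)
    (h2 : ∀ μ ν r, r ≤ φ.val μ → r ≤ φ.val ν → r ≤ φ.val (fun x => μ x ⊓ ν x))
    (h3 : ∀ μ s, s < φ.val μ → φ.val (fun x => T.imp s (μ x)) = 1) :
    (powerOp T X).IsCauchyWeight φ := by
  refine isCauchyWeight_of_exists_lt (fun t ht => ⟨fun _ => 1, by rwa [h1]⟩)
    fun μ ν r s t hr hs ht => ?_
  obtain ⟨r', hrr', hr'⟩ := exists_between hr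
  obtain ⟨s', hss', hs'⟩ := exists_between hs
  -- The least common upper bound of `μ` to degree `r'` and `ν` to degree `s'` in the opposite
  -- order.
  refine ⟨fun x => T.imp r' (μ x) ⊓ T.imp s' (ν x),
    ht.trans_le (h2 _ _ 1 (h3 μ r' hr').ge (h3 ν s' hs').ge), hrr'.trans_le ?_, hss'.trans_le ?_⟩
  · refine le_powerOp_hom.2 fun x => ?_
    rw [T.mul_comm]
    exact (T.mul_mono _ _ _ inf_le_left).trans (T.mul_imp_le _ _)
  · refine le_powerOp_hom.2 fun x => ?_
    rw [T.mul_comm]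
    exact (T.mul_mono _ _ _ inf_le_right).trans (T.mul_imp_le _ _)

/-- The pointwise weighted infimum of Cauchy weights. -/
noncomputable def infWeight {A : UOrder T X} (w : A.CauchyWeight → I) : A.Weight where
  val a := T.sub w fun φ => φ.1.val a
  lower x y := T.le_sub_iff.2 fun φ => by
    rw [← T.mul_assoc]
    exact (T.mul_le_mul (T.mul_sub_le w _ φ) le_rfl).trans (φ.1.lower x y)

/-- Each filter condition passes to weighted infima; only the third needs (S). -/
theorem isCauchyWeight_infWeight (hS : T.CondS) (w : (powerOp T X).CauchyWeight → I) :
    (powerOp T X).IsCauchyWeight (infWeight w) := by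
  refine isCauchyWeight_powerOp ?_ (fun μ ν r hμ hν => ?_) fun μ s hs => ?_
  · exact T.sub_eq_one_iff.2 fun φ => φ.2.val_one.symm ▸ le_top
  · exact T.le_sub_iff.2 fun φ =>
      φ.2.val_inf (T.le_sub_iff.1 hμ φ) (T.le_sub_iff.1 hν φ)
  · exact T.sub_eq_one_iff.2 fun φ => φ.2.le_val_imp hS (hs.trans_le (iInf_le _ φ))

theorem complete_cauchyWeights_powerOp (hS : T.CondS) :
    (powerOp T X).cauchyWeights.Complete := by
  refine complete_of_exists_isInfFam fun w =>
    ⟨⟨infWeight w, isCauchyWeight_infWeight hS w⟩, fun ψ => eq_of_forall_le_iff fun t => ?_⟩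
  refine T.le_sub_iff.trans (Iff.trans ?_ T.le_sub_iff.symm)
  have h : ∀ φ : (powerOp T X).CauchyWeight, T.mul (w φ) t ≤ T.sub ψ.1.val φ.1.val ↔
      ∀ a, T.mul (w φ) (T.mul (ψ.1.val a) t) ≤ φ.1.val a := fun φ => by
    simp only [T.le_sub_iff, T.mul_left_comm]
  refine Iff.trans ?_ (forall_congr' h).symm
  rw [forall_comm]
  exact forall_congr' fun a => T.le_sub_iff

/-- The characteristic function of a point. -/
noncomputable def single (x : X) : X → I := by
  classical exact fun y => if y = x then 1 else 0

theorem powerOp_hom_single (μ : X → I) (x : X) : (powerOp T X).hom μ (single x) = μ x := by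
  refine eq_of_forall_le_iff fun t => le_powerOp_hom.trans ⟨fun h => ?_, fun h y => ?_⟩
  · simpa [single, T.one_mul] using h x
  · by_cases hy : y = x
    · simpa [single, hy, T.one_mul] using h
    · simp [single, hy, T.zero_mul]

theorem sub_single (x : X) (ν : X → I) : T.sub (single x) ν = ν x :=
  powerOp_hom_single (T := T) ν x

/-- The representable at `μ` is the infimum of the generators weighted by `μ` itself. -/
theorem cauchyWeights_powerOp_hom_yoneda (ψ : (powerOp T X).CauchyWeight) (μ : X → I) :
    (powerOp T X).cauchyWeights.hom ψ ((powerOp T X).cauchyYoneda μ) = T.sub μ fun x =>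
      (powerOp T X).cauchyWeights.hom ψ ((powerOp T X).cauchyYoneda (single x)) := by
  have h : ∀ x, (powerOp T X).cauchyWeights.hom ψ ((powerOp T X).cauchyYoneda (single x)) =
      T.sub ψ.1.val fun ν => ν x := fun x => by
    simp only [← powerOp_hom_single (T := T) _ x]; rfl
  simp only [h]
  refine eq_of_forall_le_iff fun t => ?_
  refine T.le_sub_iff.trans (Iff.trans ?_ T.le_sub_iff.symm)
  simp only [T.le_sub_iff]
  rw [forall_comm]
  refine forall_congr' fun ν => le_powerOp_hom.trans (forall_congr' fun x => ?_)
  rw [T.mul_left_comm]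

end UOrder

/-- The free continuous `[0,1]`-lattice on a set. -/
noncomputable def ConLat.free (T : ContTNorm) (hS : T.CondS) (X : Type u) : ConLat.{u} T where
  carrier := (UOrder.powerOp T X).CauchyWeight
  order := (UOrder.powerOp T X).cauchyWeights
  isContinuousLattice := ⟨⟨UOrder.separated_cauchyWeights _,
    UOrder.complete_cauchyWeights_powerOp hS⟩, UOrder.separated_cauchyWeights _,
    UOrder.hasDomainString_cauchyWeights _⟩

/-! ### Universal property of the free lattice -/

namespace ConLat

open UOrder

variable {T : ContTNorm}

/-- The insertion of generators. -/
noncomputable def freeUnit (T : ContTNorm) (hS : T.CondS) (X : Type u) (x : X) :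
    (free T hS X).carrier := (powerOp T X).cauchyYoneda (single x)

/-- Morphisms out of the free lattice are determined by the generators. -/
theorem Hom.ext_free (hS : T.CondS) {X : Type u} {L : ConLat.{u} T} (k k' : Hom (free T hS X) L)
    (h : ∀ x, k.toFun (freeUnit T hS X x) = k'.toFun (freeUnit T hS X x)) : k = k' := by
  have hsep : L.order.Separated := L.isContinuousLattice.1.1
  have hy : ∀ μ, k.toFun ((powerOp T X).cauchyYoneda μ) =
      k'.toFun ((powerOp T X).cauchyYoneda μ) := fun μ => by
    -- Right adjoints preserve the infimum that expresses a representable through generators.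
    have main : ∀ k : Hom (free T hS X) L, L.order.IsInfFam μ
        (fun x => k.toFun (freeUnit T hS X x)) (k.toFun ((powerOp T X).cauchyYoneda μ)) :=
      fun k => by
        obtain ⟨l, hl⟩ := k.isRightAdjoint
        exact hl.isInfFam (w := μ) (x := freeUnit T hS X) (a := (powerOp T X).cauchyYoneda μ)
          fun ψ => cauchyWeights_powerOp_hom_yoneda ψ μ
    have e := main k'
    simp only [← h] at e
    exact (main k).unique hsep e
  refine Hom.ext (funext fun φ => ?_)
  -- Every Cauchy weight is the Cauchy supremum of representables, which Scott continuity preserves.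
  have main : ∀ k : Hom (free T hS X) L, L.order.IsSupFam φ.1.val
      (fun μ => k.toFun ((powerOp T X).cauchyYoneda μ)) (k.toFun φ) := fun k => by
    have hk := k.scottContinuous.2 _ (φ.2.push (preserves_yoneda _)) φ (isSup_push_yoneda _ φ)
    have e := push_comp (preserves_yoneda _) k.scottContinuous.1 φ.2
    exact isSup_push_iff.1 (Eq.mp (congrArg (fun ψ => L.order.IsSup ψ (k.toFun φ)) e) hk)
  have e := main k'
  simp only [← hy] at e
  exact (main k).unique hsep e

/-- Let `m(μ)` be the infimum of `h` weighted by `μ`; its left adjoint is `z ↦ L(z, h(-))`. The lift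
is `sup ∘ 𝒟m`, whose left adjoint is `d` followed by the direct image along that left adjoint. -/
theorem exists_free_lift (hS : T.CondS) {X : Type u} (L : ConLat.{u} T) (h : X → L.carrier) :
    ∃ k : Hom (free T hS X) L, ∀ x, k.toFun (freeUnit T hS X x) = h x := by
  obtain ⟨⟨hsep, hcomp⟩, -, d, s, hds, hsy⟩ := L.isContinuousLattice
  choose m hm using fun μ : X → I => hcomp.exists_isInfFam μ h
  have hadj : Adjoint L.order (powerOp T X) (fun z x => L.order.hom z (h x)) m :=
    fun z μ => (hm μ z).symm
  have hsup : ∀ φ : (powerOp T X).CauchyWeight,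
      L.order.IsSupFam φ.1.val m (s (cauchyPush hadj.preserves_right φ)) := fun φ =>
    isSup_push_iff.1 (hsy.isSup (cauchyPush hadj.preserves_right φ))
  refine ⟨⟨fun φ => s (cauchyPush hadj.preserves_right φ), ⟨?_, fun Φ hΦ a ha => ?_⟩,
    fun z => cauchyPush hadj.preserves_left (d z), fun z φ => ?_⟩, fun x => ?_⟩
  · exact fun φ ψ => (preserves_cauchyPush hadj.preserves_right φ ψ).trans
      (hsy.preserves_left _ _)
  · obtain rfl : (powerOp T X).cauchyJoin ⟨Φ, hΦ⟩ = a :=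
      IsSupFam.unique (separated_cauchyWeights _) (isSup_cauchyJoin _ ⟨Φ, hΦ⟩) ha
    refine isSup_push_iff.2 fun y => (hsup _ y).trans (eq_of_forall_le_iff fun t => ?_)
    refine T.le_sub_iff.trans (Iff.trans ?_ T.le_sub_iff.symm)
    constructor
    · intro H φ
      rw [hsup φ y]
      refine T.le_sub_iff.2 fun μ => ?_
      rw [← T.mul_assoc, T.mul_comm (φ.1.val μ)]
      exact (T.mul_le_mul (mul_val_le_val_yoneda Φ φ μ) le_rfl).trans (H μ)
    · intro H μ
      refine (H ((powerOp T X).cauchyYoneda μ)).trans ?_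
      rw [hsup _ y]
      have H' := T.mul_sub_le ((powerOp T X).yoneda μ).val (fun ν => L.order.hom (m ν) y) μ
      change T.mul ((powerOp T X).hom μ μ) _ ≤ _ at H'
      rwa [hom_refl, T.one_mul] at H'
  · exact (cauchyPush_adjoint hadj _ φ).trans (hds z _)
  · refine (hsup (freeUnit T hS X x)).unique hsep fun y => ?_
    have hx : m (single x) = h x := hsep.eq_of_hom_right fun z => by
      rw [hm, sub_single]
    refine eq_of_forall_le_iff fun t => ?_
    refine Iff.trans ?_ T.le_sub_iff.symm
    change _ ↔ ∀ μ, T.mul ((powerOp T X).hom μ (single x)) t ≤ L.order.hom (m μ) y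
    constructor
    · intro H μ
      rw [← hx] at H
      exact (T.mul_le_mul (hadj.preserves_right _ _) H).trans (hom_trans' _ _ _ _)
    · intro H
      simpa only [hom_refl, T.one_mul, hx] using H (single x)

end ConLat

namespace UOrder

variable {T : ContTNorm} {X Y Z : Type u}

/-! ### Coreflective quotients -/

/-- Infima and Cauchy suprema are computed in `B` through `l` and brought back by `h`; the domain
map is `𝒟h ∘ d ∘ l`. -/
theorem isContinuousLattice_of_retract {B : UOrder T Y} {C : UOrder T Z}
    (hB : B.IsContinuousLattice) {l : Z → Y} {h : Y → Z} (hadj : Adjoint C B l h)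
    (hl : ∀ c, h (l c) = c) (hsc : ScottContinuous B C h) : C.IsContinuousLattice := by
  obtain ⟨⟨hsep, hcomp⟩, -, d, s, hds, hsy⟩ := hB
  have hom_l : ∀ c c', B.hom (l c) (l c') = C.hom c c' := fun c c' => by rw [hadj, hl]
  have hsepC : C.Separated := fun c c' h1 h2 => by
    rw [← hl c, ← hl c', hsep (l c) (l c') (by rw [hom_l, h1]) (by rw [hom_l, h2])]
  have hcompC : C.Complete := complete_of_exists_isInfFam fun w => by
    obtain ⟨a, ha⟩ := hcomp.exists_isInfFam w l
    exact ⟨h a, fun y => by rw [← hadj, ha]; simp only [hom_l, id]⟩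
  have hpush : ∀ φ : C.CauchyWeight,
      cauchyPush hsc.1 (cauchyPush hadj.preserves_left φ) = φ := fun φ => Subtype.ext <| by
    have e := push_comp hadj.preserves_left hsc.1 φ.2
    rw [show h ∘ l = id from funext hl, push_id φ.2] at e
    exact e
  have hsup : ∀ φ : C.CauchyWeight, C.IsSup φ.1 (h (s (cauchyPush hadj.preserves_left φ))) :=
    fun φ => by
      have e := hsc.2 _ (cauchyPush hadj.preserves_left φ).2 _ (hsy.isSup _)
      have e' := congrArg Subtype.val (hpush φ)
      simp only [cauchyPush] at e'
      exact Eq.mp (congrArg (fun ψ => C.IsSup ψ _) e') e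
  have hsyC := adjoint_cauchyYoneda hsup
  -- From `sup ∘ y = id` by passing to left adjoints.
  have hsd : ∀ b, s (d b) = b := fun b => hsep.eq_of_hom_left fun y => by
    have e : s (B.cauchyYoneda y) = y :=
      IsSupFam.unique hsep (hsy.isSup (B.cauchyYoneda y)) (B.isSup_yoneda y)
    rw [hsy, hds, e]
  refine ⟨⟨hsepC, hcompC⟩, hsepC, fun c => cauchyPush hsc.1 (d (l c)), _, fun c φ => ?_, hsyC⟩
  apply le_antisymm
  · refine (hsyC.preserves_left _ φ).trans_eq ?_
    congr 1
    refine IsSupFam.unique hsepC (hsup (cauchyPush hsc.1 (d (l c)))) ?_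
    have e := hsc.2 _ (d (l c)).2 _ (hsy.isSup _)
    rw [hsd, hl] at e
    exact e
  · rw [← hadj, ← hds]
    refine (preserves_cauchyPush hsc.1 _ _).trans_eq ?_
    rw [hpush]

/-! ### Limits inferior of nets -/

theorem netVal_eq_iSup {A : UOrder T X} {ι : Type u} [Preorder ι] {x z : ι → X}
    (hz : ∀ i, A.IsInfFam (fun _ : Set.Ici i => 1) (fun j => x j) (z i)) (a : X) :
    A.netVal x a = ⨆ i, A.hom a (z i) := by
  refine iSup_congr fun i => ?_
  rw [hz i, ContTNorm.sub, iInf_subtype']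
  simp only [T.one_imp]
  rfl

theorem hom_mono_of_isInfFam {A : UOrder T X} {ι : Type u} [Preorder ι] {x z : ι → X}
    (hz : ∀ i, A.IsInfFam (fun _ : Set.Ici i => 1) (fun j => x j) (z i)) {i j : ι} (hij : i ≤ j) :
    A.hom (z i) (z j) = 1 := by
  refine hom_eq_one_of_le ?_
  conv_rhs => rw [hz j]
  exact T.le_sub_iff.2 fun k => (hz i).mul_hom_le (z i) ⟨k.1, hij.trans k.2⟩

theorem isCauchyNet_of_mono {A : UOrder T X} {ι : Type u} [Preorder ι] [Nonempty ι] {z : ι → X}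
    (hz : ∀ i j, i ≤ j → A.hom (z i) (z j) = 1) : A.IsCauchyNet z := by
  refine le_antisymm le_top (le_iSup_of_le (Classical.arbitrary ι) ?_)
  exact le_iInf fun j => le_iInf fun l => le_iInf fun _ => le_iInf fun hl => (hz j l hl).ge

theorem netVal_eq_iSup_of_mono {A : UOrder T X} {ι : Type u} [Preorder ι] {z : ι → X}
    (hz : ∀ i j, i ≤ j → A.hom (z i) (z j) = 1) (a : X) : A.netVal z a = ⨆ i, A.hom a (z i) :=
  iSup_congr fun i => le_antisymm (iInf₂_le i le_rfl)
    (le_iInf₂ fun j hj => hom_le_hom_right (hz i j hj) a)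

/-- The net of tail infima is monotone, hence Cauchy, and defines the same function. Arbitrary nets
must be allowed, since set-theoretic sections destroy the Cauchy property. -/
theorem Complete.exists_weight_eq_netVal {A : UOrder T X} (hA : A.Complete) {ι : Type u}
    [Preorder ι] [IsDirectedOrder ι] [Nonempty ι] (x : ι → X) :
    ∃ φ : A.Weight, A.IsCauchyWeight φ ∧ φ.val = A.netVal x := by
  choose z hz using fun i => hA.exists_isInfFam (fun _ : Set.Ici i => 1) fun j => x j.1
  have hmono : ∀ i j, i ≤ j → A.hom (z i) (z j) = 1 := fun i j => hom_mono_of_isInfFam hz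
  refine ⟨⟨A.netVal x, fun a b => ?_⟩, ⟨ι, inferInstance, inferInstance, inferInstance, z,
    isCauchyNet_of_mono hmono, funext fun a => ?_⟩, rfl⟩
  · rw [netVal_eq_iSup hz, netVal_eq_iSup hz, T.iSup_mul]
    exact iSup_mono fun i => A.hom_trans _ _ _
  · exact (netVal_eq_iSup hz a).trans (netVal_eq_iSup_of_mono hmono a).symm

/-- `a` is the limit inferior of the net `x`. -/
def IsLimInf (A : UOrder T X) {ι : Type u} [Preorder ι] (x : ι → X) (a : X) : Prop :=
  A.IsSupFam (A.netVal x) id a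

theorem IsContinuousLattice.exists_isLimInf {A : UOrder T X} (hA : A.IsContinuousLattice)
    {ι : Type u} [Preorder ι] [IsDirectedOrder ι] [Nonempty ι] (x : ι → X) :
    ∃ a, A.IsLimInf x a := by
  obtain ⟨φ, hφ, e⟩ := hA.1.2.exists_weight_eq_netVal x
  obtain ⟨a, ha⟩ := hA.2.2.exists_isSup hφ
  exact ⟨a, fun y => by rw [← e]; exact ha y⟩

/-- Right adjointness preserves the tail infima, and Scott continuity preserves their supremum. -/
theorem IsLimInf.map {A : UOrder T X} {B : UOrder T Y} (hA : A.Complete) {f : X → Y} {l : Y → X}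
    (hf : ScottContinuous A B f) (hl : Adjoint B A l f) {ι : Type u} [Preorder ι]
    [IsDirectedOrder ι] [Nonempty ι] {x : ι → X} {a : X} (ha : A.IsLimInf x a) :
    B.IsLimInf (f ∘ x) (f a) := by
  choose z hz using fun i => hA.exists_isInfFam (fun _ : Set.Ici i => 1) fun j => x j.1
  have hmono : ∀ i j, i ≤ j → A.hom (z i) (z j) = 1 := fun i j => hom_mono_of_isInfFam hz
  obtain ⟨φ, hφ, e⟩ := hA.exists_weight_eq_netVal x
  have h1 := hf.2 φ hφ a (fun y => by
    change A.hom a y = T.sub φ.val _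
    rw [e]; exact ha y)
  have h2 : φ.val = A.netVal z := by
    rw [e]
    exact funext fun a => (netVal_eq_iSup hz a).trans (netVal_eq_iSup_of_mono hmono a).symm
  have hz' : ∀ i, B.IsInfFam (fun _ : Set.Ici i => 1) (fun j => (f ∘ x) j) (f (z i)) :=
    fun i => hl.isInfFam (hz i)
  have h3 : (push A B f φ).val = B.netVal (f ∘ x) := by
    rw [push_val_netVal hf.1 (isCauchyNet_of_mono hmono) h2]
    funext b
    rw [netVal_eq_iSup hz', netVal_eq_iSup_of_mono]
    · rfl
    · exact fun i j => hom_mono_of_isInfFam hz'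
  intro y
  rw [← h3]
  exact h1 y

/-! ### Quotients by split pairs -/

section Split

variable {A : UOrder T X} {B : UOrder T Y} {f g : X → Y} {lf lg : Y → X} {h : Y → Z} {s : Z → Y}
  {t : Y → X}

/-- Lift the family along `t` and take its infimum in `A`: `g` sends it to the infimum of `x`, `f`
to that of `s ∘ h ∘ x`, and `h` identifies the two. The latter depends only on `h ∘ x`. -/
theorem IsInfFam.map_eq_of_split (hA : A.Complete) (hB : B.Complete) (hsep : B.Separated)
    (hf : Adjoint B A lf f)
    (hg : Adjoint B A lg g) (hfg : ∀ x, h (f x) = h (g x)) (hgt : ∀ y, g (t y) = y)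
    (hft : ∀ y, f (t y) = s (h y)) {ι : Type*} {w : ι → I} {x x' : ι → Y} {a a' : Y}
    (ha : B.IsInfFam w x a) (ha' : B.IsInfFam w x' a') (hx : ∀ i, h (x i) = h (x' i)) :
    h a = h a' := by
  have main : ∀ {x : ι → Y} {a b : Y}, B.IsInfFam w x a →
      B.IsInfFam w (fun i => s (h (x i))) b → h a = h b := fun {x a b} ha hb => by
    obtain ⟨c, hc⟩ := hA.exists_isInfFam w (t ∘ x)
    have h1 := hg.isInfFam hc
    have h2 := hf.isInfFam hc
    simp only [Function.comp_def, hgt, hft] at h1 h2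
    rw [ha.unique hsep h1, hb.unique hsep h2, hfg]
  obtain ⟨b, hb⟩ := hB.exists_isInfFam w fun i => s (h (x i))
  have hb' := hb
  simp only [hx] at hb'
  exact (main ha hb).trans (main ha' hb').symm

theorem IsLimInf.map_eq_of_split (hA : A.IsContinuousLattice) (hB : B.IsContinuousLattice)
    (hfs : ScottContinuous A B f) (hgs : ScottContinuous A B g)
    (hf : Adjoint B A lf f) (hg : Adjoint B A lg g)
    (hfg : ∀ x, h (f x) = h (g x)) (hgt : ∀ y, g (t y) = y)
    (hft : ∀ y, f (t y) = s (h y)) {ι : Type u} [Preorder ι] [IsDirectedOrder ι] [Nonempty ι]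
    {x x' : ι → Y} {a a' : Y}
    (ha : B.IsLimInf x a) (ha' : B.IsLimInf x' a') (hx : ∀ i, h (x i) = h (x' i)) :
    h a = h a' := by
  have hsep := hB.1.1
  have main : ∀ {x : ι → Y} {a b : Y}, B.IsLimInf x a →
      B.IsLimInf (fun i => s (h (x i))) b → h a = h b := fun {x a b} ha hb => by
    obtain ⟨c, hc⟩ := hA.exists_isLimInf (t ∘ x)
    have h1 := hc.map hA.1.2 hgs hg
    have h2 := hc.map hA.1.2 hfs hf
    simp only [Function.comp_def, hgt, hft] at h1 h2
    rw [IsSupFam.unique hsep ha h1, IsSupFam.unique hsep hb h2, hfg]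
  obtain ⟨b, hb⟩ := hB.exists_isLimInf fun i => s (h (x i))
  have hb' := hb
  simp only [hx] at hb'
  exact (main ha hb).trans (main ha' hb').symm

theorem exists_quotient_of_split (hA : A.IsContinuousLattice) (hB : B.IsContinuousLattice)
    (hfs : ScottContinuous A B f) (hgs : ScottContinuous A B g)
    (hf : Adjoint B A lf f) (hg : Adjoint B A lg g)
    (hfg : ∀ x, h (f x) = h (g x)) (hhs : ∀ c, h (s c) = c) (hgt : ∀ y, g (t y) = y)
    (hft : ∀ y, f (t y) = s (h y)) :
    ∃ (C : UOrder T Z) (l : Z → Y), C.IsContinuousLattice ∧ ScottContinuous B C h ∧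
      Adjoint C B l h ∧ ∀ c, h (l c) = c := by
  have hsep := hB.1.1
  have hcomp := hB.1.2
  -- The least element of the fibre over `c`, which lies in the fibre because `h` respects infima.
  choose l hl using fun c : Z => hcomp.exists_isInfFam (fun _ : {b // h b = c} => 1) fun b => b.1
  have hhl : ∀ c, h (l c) = c := fun c => by
    refine (IsInfFam.map_eq_of_split hA.1.2 hcomp hsep hf hg hfg hgt hft (hl c)
      (x' := fun _ => s c) (a' := s c) (fun y => ?_) fun b => ?_).trans (hhs c)
    · have : Nonempty {b // h b = c} := ⟨⟨s c, hhs c⟩⟩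
      simp only [ContTNorm.sub, T.one_imp, ciInf_const]
    · rw [b.2, hhs]
  have hle : ∀ b c, h b = c → B.hom (l c) b = 1 := fun b c e => by
    refine hom_eq_one_of_le ?_
    simpa only [T.one_mul] using (hl c).mul_hom_le (l c) ⟨b, e⟩
  have hlb : ∀ c b, B.hom (l c) b = B.hom (l c) (l (h b)) := fun c b => by
    refine le_antisymm ?_ (hom_le_hom_right (hle b _ rfl) _)
    set r := B.hom (l c) b with hr
    -- Here `e` is `l c ⊓ (r → l (h b))`, congruent to `l c ⊓ (r → b) = l c`. Thus `e` lies over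
    -- `c`, so `l c ≤ e ≤ r → l (h b)`.
    obtain ⟨e, he⟩ := hcomp.exists_isInfFam (fun i : Bool => bif i then 1 else r)
      fun i => bif i then l c else l (h b)
    have hlc : B.IsInfFam (fun i : Bool => bif i then 1 else r)
        (fun i => bif i then l c else b) (l c) := fun y => by
      refine eq_of_forall_le_iff fun k => Iff.trans ?_ T.le_sub_iff.symm
      simp only [Bool.forall_bool, cond_true, cond_false, T.one_mul]
      refine ⟨fun H => ⟨?_, H⟩, fun H => H.2⟩
      rw [T.mul_comm]
      exact (T.mul_le_mul H le_rfl).trans (B.hom_trans' y (l c) b)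
    have hec : h e = c := by
      rw [← hhl c]
      refine IsInfFam.map_eq_of_split hA.1.2 hcomp hsep hf hg hfg hgt hft he hlc fun i => ?_
      cases i
      · exact hhl _
      · rfl
    have H := (hle e c hec).ge.trans_eq (he (l c))
    simpa only [cond_false, T.mul_one] using T.le_sub_iff.1 H false
  let C : UOrder T Z :=
    { hom := fun c c' => B.hom (l c) (l c')
      hom_refl := fun c => B.hom_refl _
      hom_trans := fun x y z => B.hom_trans _ _ _ }
  have hadj : Adjoint C B l h := hlb
  have hsc : ScottContinuous B C h := by
    refine ⟨hadj.preserves_right, ?_⟩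
    rintro φ ⟨ι, _, _, _, x, hx, e⟩ a ha
    refine isSup_push_iff.2 fun y => le_antisymm ?_ ?_
    · refine T.le_sub_iff.2 fun b => ?_
      have hb : φ.val b ≤ B.hom b a := by
        have H := T.le_sub_iff.1 ((B.hom_refl a).ge.trans_eq (ha a)) b
        rwa [T.mul_one] at H
      exact (T.mul_le_mul (hb.trans (hadj.preserves_right _ _)) le_rfl).trans
        (C.hom_trans' _ _ _)
    · set r := T.sub φ.val fun b => C.hom (h b) y
      -- With `v = r → l y` and `p` the limit inferior of `l (h (x i))`, congruence gives `h a = h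
      -- p`, whence `l (h a) ≤ p ≤ v`; this is the required bound by `r`.
      obtain ⟨v, hv⟩ := hcomp.exists_isInfFam (fun _ : Unit => r) fun _ => l y
      have hv' : ∀ b, B.hom b v = T.imp r (B.hom b (l y)) := fun b => by
        rw [hv]; simp only [ContTNorm.sub, ciInf_const]
      obtain ⟨p, hp⟩ := hB.exists_isLimInf fun i => l (h (x i))
      have hap : h a = h p := by
        refine IsLimInf.map_eq_of_split hA hB hfs hgs hf hg hfg hgt hft (x := x) ?_ hp
          fun i => (hhl _).symm
        intro y
        rw [← e]
        exact ha y
      have hpv : B.hom p v = 1 := by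
        rw [hp v]
        refine T.sub_eq_one_iff.2 fun b => iSup_le fun i => T.le_of_forall_mul_le fun k hk => ?_
        obtain ⟨j, hj⟩ := lt_iSup_iff.1 (hk.trans_eq hx.symm)
        obtain ⟨m, him, hjm⟩ := exists_ge_ge i j
        refine (T.mul_le_mul (iInf₂_le m him) ?_).trans (B.hom_trans' _ (l (h (x m))) _)
        rw [hv', T.le_imp_iff, T.mul_comm]
        refine le_trans (T.mul_le_mul ?_ le_rfl)
          (T.mul_sub_le φ.val (fun b => C.hom (h b) y) (x m))
        rw [e]
        refine hj.le.trans (le_iSup_of_le m (le_iInf₂ fun n hn => ?_))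
        exact (iInf_le _ m).trans ((iInf_le _ n).trans ((iInf_le _ hjm).trans (iInf_le _ hn)))
      have hav : B.hom (l (h a)) v = 1 := by
        rw [hap]
        exact le_antisymm le_top (hpv.ge.trans (hom_le_hom_left (hle p _ rfl) v))
      rw [hv'] at hav
      exact T.imp_eq_one_iff.1 hav
  exact ⟨C, l, isContinuousLattice_of_retract hB hadj hhl hsc, hsc, hadj, hhl⟩

end Split

end UOrder

/-! ### Monadicity by Beck's theorem -/

namespace ConLat

open UOrder Limits

variable {T : ContTNorm}

theorem comp_toFun {A B C : ConLat.{u} T} (f : A ⟶ B) (g : B ⟶ C) :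
    Hom.toFun (f ≫ g) = Hom.toFun g ∘ Hom.toFun f := rfl

/-! ### The free functor -/

/-- Morphisms out of the free lattice correspond to maps out of the generating set. -/
noncomputable def freeHomEquiv (hS : T.CondS) (X : Type u) (L : ConLat.{u} T) :
    (free T hS X ⟶ L) ≃ (X ⟶ (forgetful T).obj L) where
  toFun k := TypeCat.ofHom fun x => Hom.toFun k (freeUnit T hS X x)
  invFun h := (exists_free_lift hS L h).choose
  left_inv k := Hom.ext_free hS _ _ fun x => (exists_free_lift hS L _).choose_spec x
  right_inv h := by
    ext x
    exact (exists_free_lift hS L h).choose_spec x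

/-- The free-forgetful adjunction. -/
noncomputable def freeAdjunction (hS : T.CondS) :
    Adjunction.leftAdjointOfEquiv (G := forgetful.{u} T) (freeHomEquiv hS) (fun _ _ _ _ _ => rfl) ⊣
      forgetful.{u} T :=
  Adjunction.adjunctionOfEquivLeft _ _

/-! ### Beck's conditions -/

/-- The left adjoint of a bijective morphism is its two-sided inverse, hence also its right adjoint;
being a left adjoint it preserves suprema. -/
theorem isIso_of_bijective {A B : ConLat.{u} T} (f : A ⟶ B)
    (hf : Function.Bijective (Hom.toFun f)) : IsIso f := by
  obtain ⟨l, hl⟩ := f.isRightAdjoint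
  have hsep : B.order.Separated := B.isContinuousLattice.1.1
  have hflf : ∀ a, l (Hom.toFun f a) = a := fun a => by
    apply hf.1
    refine hsep _ _ (le_antisymm le_top ?_) (le_antisymm le_top ?_)
    · exact ((B.order.hom_refl _).ge.trans_eq (hl _ a).symm).trans (f.scottContinuous.1 _ _)
    · rw [← hl, A.order.hom_refl]
  have hfl : ∀ b, Hom.toFun f (l b) = b := fun b => by
    obtain ⟨a, rfl⟩ := hf.2 b
    rw [hflf]
  have hadj : Adjoint A.order B.order (Hom.toFun f) l := fun a b => by
    rw [← hfl b, ← hl, hflf, hflf]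
  refine ⟨⟨l, ⟨hl.preserves_left, fun φ _ a ha => isSup_push_iff.2 ?_⟩, _, hadj⟩, ?_, ?_⟩
  · exact hl.isSupFam ha
  · exact Hom.ext (funext hflf)
  · exact Hom.ext (funext hfl)

instance : (forgetful.{u} T).ReflectsIsomorphisms where
  reflects f h := isIso_of_bijective f ((isIso_iff_bijective _).1 h)

/-- Descent of a morphism along a quotient by a split pair. -/
theorem exists_descent {B C D : ConLat.{u} T} (q : B ⟶ C) {l : C.carrier → B.carrier}
    (hl : Adjoint C.order B.order l (Hom.toFun q)) (hql : ∀ c, Hom.toFun q (l c) = c)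
    (k : B ⟶ D) (hk : ∀ b, Hom.toFun k (l (Hom.toFun q b)) = Hom.toFun k b) :
    ∃ m : C ⟶ D, q ≫ m = k := by
  obtain ⟨r, hr⟩ := k.isRightAdjoint
  refine ⟨⟨Hom.toFun k ∘ l, ⟨?_, fun φ hφ a ha => ?_⟩, Hom.toFun q ∘ r, fun d c => ?_⟩,
    Hom.ext (funext hk)⟩
  · exact fun c c' => (hl.preserves_left c c').trans (k.scottContinuous.1 _ _)
  · have e := k.scottContinuous.2 _ (hφ.push hl.preserves_left) (l a)
      (isSup_push_iff.2 (hl.isSupFam ha))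
    rwa [push_comp hl.preserves_left k.scottContinuous.1 hφ] at e
  · apply le_antisymm
    · refine (hl.preserves_left _ _).trans ((k.scottContinuous.1 _ _).trans ?_)
      simp only [Function.comp, hk]
      exact hom_le_hom_left (by rw [← hr, B.order.hom_refl]) _
    · refine (hr d (l c)).ge.trans ((q.scottContinuous.1 _ _).trans_eq ?_)
      rw [hql]
      rfl

theorem exists_isColimit_of_split {A B : ConLat.{u} T} (f g : A ⟶ B)
    [h : (forgetful.{u} T).IsSplitPair f g] :
    ∃ (C : ConLat.{u} T) (q : B ⟶ C) (w : f ≫ q = g ≫ q),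
      Nonempty (IsColimit (Cofork.ofπ q w)) ∧
      Nonempty (IsColimit ((forgetful T).mapCocone (Cofork.ofπ q w))) := by
  obtain ⟨Z, π, ⟨S⟩⟩ := h.splittable
  obtain ⟨lf, hf⟩ := f.isRightAdjoint
  obtain ⟨lg, hg⟩ := g.isRightAdjoint
  have e1 : ∀ x, π (Hom.toFun f x) = π (Hom.toFun g x) := fun x =>
    ConcreteCategory.congr_hom S.condition x
  have e2 : ∀ c, π (S.rightSection c) = c := fun c =>
    ConcreteCategory.congr_hom S.rightSection_π c
  have e3 : ∀ b, Hom.toFun g (S.leftSection b) = b := fun b =>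
    ConcreteCategory.congr_hom S.leftSection_bottom b
  have e4 : ∀ b, Hom.toFun f (S.leftSection b) = S.rightSection (π b) := fun b =>
    ConcreteCategory.congr_hom S.leftSection_top b
  obtain ⟨C, l, hC, hsc, hadj, hl⟩ := exists_quotient_of_split A.isContinuousLattice
    B.isContinuousLattice f.scottContinuous g.scottContinuous hf hg e1 e2 e3 e4
  let C' : ConLat.{u} T := ⟨Z, C, hC⟩
  let q : B ⟶ C' := ⟨π, hsc, l, hadj⟩
  have w : f ≫ q = g ≫ q := Hom.ext (funext e1)
  refine ⟨C', q, w, ⟨Cofork.IsColimit.mk' _ fun c => ?_⟩,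
    ⟨(isColimitMapCoconeCoforkEquiv _ w).symm S.isCoequalizer⟩⟩
  -- The splitting makes any map coequalizing `f` and `g` constant on the fibres of `π`.
  have hk : ∀ b b', π b = π b' → Hom.toFun c.π b = Hom.toFun c.π b' := by
    have hc : ∀ x, Hom.toFun c.π (Hom.toFun f x) = Hom.toFun c.π (Hom.toFun g x) := fun x =>
      congrFun (congrArg Hom.toFun c.condition) x
    have main : ∀ b, Hom.toFun c.π b = Hom.toFun c.π (S.rightSection (π b)) := fun b =>
      (congrArg (Hom.toFun c.π) (e3 b).symm).trans
        ((hc _).symm.trans (congrArg (Hom.toFun c.π) (e4 b)))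
    intro b b' e
    exact (main b).trans ((congrArg (fun z => Hom.toFun c.π (S.rightSection z)) e).trans
      (main b').symm)
  have hd := exists_descent q hadj hl c.π fun b => hk _ _ (hl _)
  refine ⟨hd.choose, hd.choose_spec, fun {m} hm => Hom.ext (funext fun y => ?_)⟩
  have e : q ≫ m = q ≫ hd.choose := hm.trans hd.choose_spec.symm
  have e' := congrFun (congrArg Hom.toFun e) (l y)
  simpa only [comp_toFun, Function.comp, show Hom.toFun q (l y) = y from hl y] using e'

instance : Monad.HasCoequalizerOfIsSplitPair (forgetful.{u} T) where
  out f g _ := by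
    obtain ⟨C, q, w, ⟨hc⟩, _⟩ := exists_isColimit_of_split f g
    exact ⟨⟨⟨_, hc⟩⟩⟩

instance : Monad.PreservesColimitOfIsSplitPair (forgetful.{u} T) where
  out f g _ := by
    obtain ⟨C, q, w, ⟨hc⟩, ⟨hc'⟩⟩ := exists_isColimit_of_split f g
    exact preservesColimit_of_preserves_colimit_cocone hc hc'

/-- The forgetful functor is monadic. -/
@[reducible]
noncomputable def monadicForgetful (hS : T.CondS) : MonadicRightAdjoint (forgetful.{u} T) :=
  Monad.monadicOfHasPreservesGSplitCoequalizersOfReflectsIsomorphisms (freeAdjunction hS)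

/-! ### Transport of structure -/

theorem eq_of_preserves {A B : ConLat.{u} T} (e : A.carrier = B.carrier)
    (h : ∀ x y, A.order.hom x y = B.order.hom (cast e x) (cast e y)) : A = B := by
  obtain ⟨X, a, ha⟩ := A
  obtain ⟨Y, b, hb⟩ := B
  obtain rfl : X = Y := e
  obtain rfl : a = b := UOrder.ext (funext fun x => funext fun y => h x y)
  rfl

/-- Transport of the structure of a continuous `[0,1]`-lattice along a bijection. -/
theorem exists_transport (A : ConLat.{u} T) {Z : Type u} (e : A.carrier ≃ Z) :
    ∃ (C : UOrder T Z) (hC : C.IsContinuousLattice) (f : A ⟶ ⟨Z, C, hC⟩),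
      IsIso f ∧ Hom.toFun f = e := by
  let C : UOrder T Z :=
    { hom := fun x y => A.order.hom (e.symm x) (e.symm y)
      hom_refl := fun x => A.order.hom_refl _
      hom_trans := fun x y z => A.order.hom_trans _ _ _ }
  have hadj : Adjoint C A.order e.symm e := fun x y => by
    change _ = A.order.hom _ (e.symm (e y))
    rw [e.symm_apply_apply]
  have hadj' : Adjoint A.order C e e.symm := fun x y => by
    change A.order.hom (e.symm (e x)) _ = _
    rw [e.symm_apply_apply]
  have hsc : ScottContinuous A.order C e :=
    ⟨hadj'.preserves_left, fun φ _ a ha => isSup_push_iff.2 (hadj'.isSupFam ha)⟩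
  let f : A ⟶ ⟨Z, C, isContinuousLattice_of_retract A.isContinuousLattice hadj
    e.apply_symm_apply hsc⟩ := ⟨e, hsc, _, hadj⟩
  exact ⟨C, _, f, isIso_of_bijective f e.bijective, rfl⟩

/-! ### Bijectivity of the comparison functor on objects -/

section Comparison

variable {F : Type u ⥤ ConLat.{u} T} (adj : F ⊣ forgetful.{u} T)

theorem algebra_ext {M : Monad (Type u)} {A B : M.Algebra} (e : A.A = B.A) (f : A ⟶ B)
    (hf : f.f = eqToHom e) : A = B := by
  obtain ⟨X, a, _, _⟩ := A
  obtain ⟨Y, b, _, _⟩ := B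
  obtain rfl : X = Y := e
  have h := f.h
  rw [hf] at h
  simp only [eqToHom_refl, Category.comp_id] at h
  have h' : M.map (𝟙 X) ≫ b = b := by
    rw [CategoryTheory.Functor.map_id]
    exact Category.id_comp b
  congr
  exact h.symm.trans h'

/-- Fullness lifts the identity of equal algebras to morphisms in both directions; these preserve
order, so the orders agree. -/
theorem comparison_obj_injective [(Monad.comparison adj).Full] :
    Function.Injective (Monad.comparison adj).obj := by
  intro A B h
  have e : A.carrier = B.carrier := congrArg Monad.Algebra.A h
  have hto : ∀ {X Y : ConLat.{u} T} (h : (Monad.comparison adj).obj X =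
      (Monad.comparison adj).obj Y) (e : X.carrier = Y.carrier) (x y : X.carrier),
      X.order.hom x y ≤ Y.order.hom (cast e x) (cast e y) := by
    intro X Y h e x y
    obtain ⟨k, hk⟩ := (Monad.comparison adj).map_surjective (eqToHom h)
    have hk' : ∀ z, Hom.toFun k z = cast e z := by
      have e' : (forgetful T).map k = eqToHom e := by
        have e1 := congrArg Monad.Algebra.Hom.f hk
        refine e1.trans ?_
        exact eqToHom_map (Monad.forget _) h
      intro z
      have e2 := ConcreteCategory.congr_hom e' z
      refine e2.trans ?_
      clear e2 e' hk h k x y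
      obtain ⟨X, a, ha⟩ := X
      obtain ⟨Y, b, hb⟩ := Y
      obtain rfl : X = Y := e
      rfl
    rw [← hk', ← hk']
    exact k.scottContinuous.1 x y
  refine eq_of_preserves e fun x y => le_antisymm (hto h e x y) ?_
  have H := hto h.symm e.symm (cast e x) (cast e y)
  rwa [cast_cast, cast_cast] at H

/-- Transport a preimage up to isomorphism along the underlying bijection; the resulting algebra
morphism lies over the identity, so the algebras coincide. -/
theorem comparison_obj_surjective [(Monad.comparison adj).EssSurj] :
    Function.Surjective (Monad.comparison adj).obj := by
  intro M
  let A := (Monad.comparison adj).objPreimage M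
  let i : (Monad.comparison adj).obj A ≅ M := (Monad.comparison adj).objObjPreimageIso M
  obtain ⟨C, hC, f, ⟨f', -, hf⟩, hfe⟩ := A.exists_transport ((Monad.forget _).mapIso i).toEquiv
  refine ⟨⟨M.A, C, hC⟩, algebra_ext rfl ((Monad.comparison adj).map f' ≫ i.hom) ?_⟩
  have h : (forgetful T).map f = i.hom.f := by
    ext x
    exact congrFun hfe x
  change (forgetful T).map f' ≫ i.hom.f = 𝟙 _
  exact (congrArg (fun z => (forgetful T).map f' ≫ z) h.symm).trans
    (((forgetful T).map_comp f' f).symm.trans (congrArg (forgetful T).map hf))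

end Comparison

end ConLat

theorem mainTheorem5 (T : ContTNorm) (hS : T.CondS) :
    ∃ h : MonadicRightAdjoint (ConLat.forgetful.{u} T),
      Function.Bijective (Monad.comparison h.adj).obj := by
  refine ⟨ConLat.monadicForgetful hS, ?_⟩
  have := (ConLat.monadicForgetful.{u} hS).eqv
  exact ⟨ConLat.comparison_obj_injective _, ConLat.comparison_obj_surjective _⟩
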